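/- Let $k\ge 1$. In the $k$-move deduction game on a finite graph $G$, searchers are first placed on vertices (several may share a vertex); this placement is called a layout. A vertex is protected once it has been occupied by a searcher. A searcher is mobile if it has moved fewer than $k$ times. At each stage, simultaneously for every vertex $v$: if the number of mobile searchers on $v$ is at least the number of unprotected neighbours of $v$, then at least one mobile searcher moves from $v$ to each unprotected neighbour of $v$, and each remaining mobile searcher on $v$ may stay or move to any of these unprotected neighbours; otherwise no searcher leaves $v$. A layout is successful if, for some choice of these moves, every vertex is eventually protected. The $k$-move deduction number $d_k(G)$ is the minimum number of searchers in a successful layout. Let $P_n$ be the path on $n$ vertices. The strong product $G\boxtimes H$ has vertex set $V(G)\times V(H)$, and two distinct vertices $(x,y)$ and $(u,v)$ are adjacent if and only if ($x=u$ or $xu\in E(G)$) and ($y=v$ or $yv\in E(H)$). **Theorem.** Suppose $k\ge 3$, $3\le m\le n$ and $k+1<n$. Let $r=m \bmod (k+1)$ and $s=n\bmod (k+1)$. Then $$d_k(P_m\boxtimes P_n)\le\begin{cases} (m+1)\frac{n}{k+1} & \text{if } s=0,\\[2pt] (m+1)\left\lfloor\frac{n}{k+1}\right\rfloor+\left\lceil\frac{m}{k+1}\right\rceil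 & \text{if } s=1,\\[2pt] (m+1)\left\lfloor\frac{n}{k+1}\right\rfloor+4\left\lfloor\frac{m}{k+1}\right\rfloor+d_k(P_r\boxtimes P_s) & \text{if } s=2,\\[2pt] (m+1)\left\lfloor\frac{n}{k+1}\right\rfloor+(s+1)\left\lfloor\frac{m}{k+1}\right\rfloor+d_k(P_r\boxtimes P_s) & \text{if } s\ge 3, \end{cases}$$ where $d_k(P_0\boxtimes P_s)=0$. -/

import Mathlib

namespace SimpleGraph

/-- The strong product `G ⊠ H`: the edges of the Cartesian (box) product, together with the pairs
`(x, y)`, `(u, v)` such that `x ~ u` in `G` and `y ~ v` in `H`. -/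
def strongProd {α β : Type*} (G : SimpleGraph α) (H : SimpleGraph β) : SimpleGraph (α × β) where
  Adj x y := (G □ H).Adj x y ∨ (G.Adj x.1 y.1 ∧ H.Adj x.2 y.2)
  symm := ⟨fun _ _ h => h.elim (fun h => Or.inl h.symm) (fun h => Or.inr ⟨h.1.symm, h.2.symm⟩)⟩
  loopless := ⟨fun x h => h.elim (fun h => (G □ H).loopless.irrefl x h)
    (fun h => G.loopless.irrefl x.1 h.1)⟩

end SimpleGraph

namespace Deduction

/-- A position of the deduction game with `ℓ` searchers on the vertex set `V`: where each searcher
is, how many times each searcher has moved, and which vertices are protected. -/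
structure State (V : Type*) (ℓ : ℕ) where
  pos : Fin ℓ → V
  moves : Fin ℓ → ℕ
  prot : Set V

variable {V : Type*} {ℓ : ℕ}

/-- The position given by a layout: nobody has moved, and the occupied vertices are protected. -/
def State.init (L : Fin ℓ → V) : State V ℓ where
  pos := L
  moves := fun _ => 0
  prot := Set.range L

/-- The mobile searchers on `v`: those on `v` that have moved fewer than `k` times. -/
def State.mobileAt (k : ℕ) (σ : State V ℓ) (v : V) : Set (Fin ℓ) :=
  {i | σ.pos i = v ∧ σ.moves i < k}

/-- The unprotected neighbours of `v`. -/
def State.unprotNbrs (G : SimpleGraph V) (σ : State V ℓ) (v : V) : Set V :=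
  {u | G.Adj v u ∧ u ∉ σ.prot}

/-- Searchers on `v` move when there are at least as many mobile searchers on `v` as there are
unprotected neighbours of `v`. -/
def State.Fires (G : SimpleGraph V) (k : ℕ) (σ : State V ℓ) (v : V) : Prop :=
  (σ.unprotNbrs G v).ncard ≤ (σ.mobileAt k v).ncard

/-- One stage of the `k`-move deduction game, played simultaneously on all vertices, leading from
the position `σ` to the position `τ`. -/
structure Stage (G : SimpleGraph V) (k : ℕ) (σ τ : State V ℓ) : Prop where
  /-- A searcher stays, or it is mobile, its vertex fires, and it moves to an unprotected
  neighbour. -/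
  searcher : ∀ i, (τ.pos i = σ.pos i ∧ τ.moves i = σ.moves i) ∨
    (σ.Fires G k (σ.pos i) ∧ σ.moves i < k ∧ τ.pos i ∈ σ.unprotNbrs G (σ.pos i) ∧
      τ.moves i = σ.moves i + 1)
  /-- From a vertex that fires, some searcher moves to each unprotected neighbour
  (excess searchers may stay or move). -/
  covers : ∀ v, σ.Fires G k v → ∀ u ∈ σ.unprotNbrs G v, ∃ i ∈ σ.mobileAt k v, τ.pos i = u
  /-- Occupied vertices become protected, and protected vertices stay so. -/
  prot_eq : τ.prot = σ.prot ∪ Set.range τ.pos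

/-- A layout is successful if the game started from it can reach, through finitely many stages, a
position in which every vertex is protected. -/
def IsSuccessful (G : SimpleGraph V) (k : ℕ) (L : Fin ℓ → V) : Prop :=
  ∃ τ : State V ℓ, Relation.ReflTransGen (Stage G k) (State.init L) τ ∧ τ.prot = Set.univ

end Deduction

/-- The `k`-move deduction number `d_k(G)` of a finite graph: the least number of searchers for
which a successful layout exists. -/
noncomputable def SimpleGraph.deductionNumber {V : Type*} [Finite V] (G : SimpleGraph V) (k : ℕ) :
    ℕ :=
  sInf {ℓ : ℕ | ∃ L : Fin ℓ → V, Deduction.IsSuccessful G k L}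

/-- On a finite graph successful layouts exist (occupy every vertex), so that the minimum in the
definition of the deduction number is attained. -/
theorem SimpleGraph.exists_isSuccessful_deductionNumber {V : Type*} [Finite V] (G : SimpleGraph V)
    (k : ℕ) : ∃ L : Fin (G.deductionNumber k) → V, Deduction.IsSuccessful G k L := by
  have h : {ℓ : ℕ | ∃ L : Fin ℓ → V, Deduction.IsSuccessful G k L}.Nonempty := by
    refine ⟨Nat.card V, (Finite.equivFin V).symm, _, Relation.ReflTransGen.refl, ?_⟩
    exact (Finite.equivFin V).symm.surjective.range_eq
  exact Nat.sInf_mem h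

/-- The graph without vertices has deduction number `0`. -/
theorem SimpleGraph.deductionNumber_of_isEmpty {V : Type*} [Finite V] [IsEmpty V]
    (G : SimpleGraph V) (k : ℕ) : G.deductionNumber k = 0 := by
  refine Nat.sInf_eq_zero.mpr (Or.inl ⟨Fin.elim0, _, Relation.ReflTransGen.refl, ?_⟩)
  exact Set.eq_univ_of_forall fun v => isEmptyElim v

/-! The grid is cut into blocks of `k + 1` consecutive rows, and each block is cleared by its own
team at a fixed price. A team starts by filling the block row next to the rest of the grid. That row
is a wall: it is protected from the outset, so the game on the remaining rows runs exactly as it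
would alone. The team's searchers wait until their neighbours in the remaining rows are protected,
then walk away from them, each moving at most once per row; `k` moves thus clear `k + 1` rows.
`Sweep` axiomatizes such a team, and `Sweep.deductionNumber_le` says that it adds only its own size
to the deduction number of the rest.

For width `w ≥ 3` a team of `w + 1` suffices (`sweep_snake`): one searcher per vertex and a second
one at one end. The doubled end has two unprotected neighbours in the next row and fires; each
following column then has a single unprotected neighbour left. The last two columns fire together
into the same corner, so the doubled vertex is now at the other end and the next row is played in
reverse. For width at most 2 a team of `w * w` suffices (`sweep_narrow`), since consecutive rows are
completely joined.

Peeling blocks of width `m` in the `n` direction costs `m + 1` each and leaves an `m × s` grid.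
Peeling blocks of width `s` in the other direction costs `s + 1` each, or 4 for `s = 2` and 1 for `s
= 1`, and leaves `r × s`. -/

namespace Deduction

variable {V W : Type*} {ℓ a : ℕ}

/-! ### Playing an embedded game beside additional searchers. -/

/-- The joint position of a game on `W`, embedded by `e` into `V`, and of further searchers with
positions `p`, move counts `c` and protected vertices `P`. -/
def State.join (σ : State W a) (e : W → V) (p : Fin ℓ → V) (c : Fin ℓ → ℕ) (P : Set V) :
    State V (a + ℓ) where
  pos := Fin.append (e ∘ σ.pos) p
  moves := Fin.append σ.moves c
  prot := e '' σ.prot ∪ P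

section Join

variable {G : SimpleGraph V} {H : SimpleGraph W} {k : ℕ} (e : H ↪g G) (σ : State W a)
  (p : Fin ℓ → V) (c : Fin ℓ → ℕ) (P : Set V)

theorem State.mobileAt_join_embedding (hp : ∀ i, p i ∉ Set.range e) (x : W) :
    (σ.join e p c P).mobileAt k (e x) = Fin.castAdd ℓ '' σ.mobileAt k x := by
  ext i
  refine Fin.addCases (fun i => ?_) (fun i => ?_) i
  · simp [State.mobileAt, State.join, Fin.castAdd_inj]
  · have h1 : p i ≠ e x := fun h => hp i ⟨x, h.symm⟩
    have h2 : ∀ j : Fin a, Fin.castAdd ℓ j ≠ Fin.natAdd a i := fun j h => by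
      have := congrArg Fin.val h
      simp only [Fin.val_castAdd, Fin.val_natAdd] at this
      omega
    simp [State.mobileAt, State.join, h1, h2]

theorem State.mobileAt_join_of_notMem {v : V} (hv : v ∉ Set.range e) :
    (σ.join e p c P).mobileAt k v = Fin.natAdd a '' {i | p i = v ∧ c i < k} := by
  ext i
  refine Fin.addCases (fun i => ?_) (fun i => ?_) i
  · have h1 : e (σ.pos i) ≠ v := fun h => hv ⟨_, h⟩
    have h2 : ∀ j : Fin ℓ, Fin.natAdd a j ≠ Fin.castAdd ℓ i := fun j h => by
      have := congrArg Fin.val h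
      simp only [Fin.val_castAdd, Fin.val_natAdd] at this
      omega
    simp [State.mobileAt, State.join, h1, h2]
  · simp [State.mobileAt, State.join]

theorem State.ncard_mobileAt_join_of_notMem {v : V} (hv : v ∉ Set.range e) :
    ((σ.join e p c P).mobileAt k v).ncard = {i | p i = v ∧ c i < k}.ncard := by
  rw [State.mobileAt_join_of_notMem e σ p c P hv]
  exact Set.ncard_image_of_injective _ (Fin.natAdd_injective _ _)

/-- The boundary of the embedded graph lies in `P`, so the embedded game never sees an unprotected
vertex outside its own graph. -/
theorem State.unprotNbrs_join_embedding (hP : Disjoint P (Set.range e))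
    (hN : ∀ x v, G.Adj (e x) v → v ∉ Set.range e → v ∈ P) (x : W) :
    (σ.join e p c P).unprotNbrs G (e x) = e '' σ.unprotNbrs H x := by
  ext v
  by_cases hv : v ∈ Set.range e
  · obtain ⟨y, rfl⟩ := hv
    have : e y ∉ P := fun h => Set.disjoint_left.mp hP h ⟨y, rfl⟩
    simp [State.unprotNbrs, State.join, this, -Set.mem_image, e.injective.mem_set_image]
  · refine iff_of_false (fun h => h.2 (Or.inr (hN x v h.1 hv))) ?_
    rintro ⟨y, -, rfl⟩
    exact hv ⟨y, rfl⟩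

theorem State.fires_join_embedding (hp : ∀ i, p i ∉ Set.range e) (hP : Disjoint P (Set.range e))
    (hN : ∀ x v, G.Adj (e x) v → v ∉ Set.range e → v ∈ P) (x : W) :
    (σ.join e p c P).Fires G k (e x) ↔ σ.Fires H k x := by
  rw [State.Fires, State.unprotNbrs_join_embedding e σ p c P hP hN,
    State.mobileAt_join_embedding e σ p c P hp,
    Set.ncard_image_of_injective _ e.injective,
    Set.ncard_image_of_injective _ (Fin.castAdd_injective _ _), State.Fires]

theorem State.mem_unprotNbrs_join {v u : V} (hu : u ∉ Set.range e) :
    u ∈ (σ.join e p c P).unprotNbrs G v ↔ G.Adj v u ∧ u ∉ P := by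
  have : ∀ x, e x ≠ u := fun x h => hu ⟨x, h⟩
  simp [State.unprotNbrs, State.join, this]

theorem State.mem_unprotNbrs_join_embedding (hP : Disjoint P (Set.range e)) {v : V} {x : W} :
    e x ∈ (σ.join e p c P).unprotNbrs G v ↔ G.Adj v (e x) ∧ x ∉ σ.prot := by
  have : e x ∉ P := fun h => Set.disjoint_left.mp hP h ⟨x, rfl⟩
  simp [State.unprotNbrs, State.join, this, -Set.mem_image, e.injective.mem_set_image]

/-- A stage of the embedded game, together with legal moves of the other searchers, is a stage of
the joint game. -/
theorem Stage.join {σ σ' : State W a} {p p' : Fin ℓ → V} {c c' : Fin ℓ → ℕ} {P P' : Set V}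
    (hσ : Stage H k σ σ') (hp : ∀ i, p i ∉ Set.range e) (hP : Disjoint P (Set.range e))
    (hN : ∀ x v, G.Adj (e x) v → v ∉ Set.range e → v ∈ P)
    (hmove : ∀ i, (p' i = p i ∧ c' i = c i) ∨ ((σ.join e p c P).Fires G k (p i) ∧ c i < k ∧
      p' i ∈ (σ.join e p c P).unprotNbrs G (p i) ∧ c' i = c i + 1))
    (hcov : ∀ v, v ∉ Set.range e → (σ.join e p c P).Fires G k v →
      ∀ u ∈ (σ.join e p c P).unprotNbrs G v, ∃ i, (p i = v ∧ c i < k) ∧ p' i = u)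
    (hP' : P' = P ∪ Set.range p') :
    Stage G k (σ.join e p c P) (σ'.join e p' c' P') where
  searcher i := by
    refine Fin.addCases (fun i => ?_) (fun i => ?_) i
    · have h1 : (σ.join e p c P).pos (Fin.castAdd ℓ i) = e (σ.pos i) := by simp [State.join]
      rw [h1, State.fires_join_embedding e σ p c P hp hP hN,
        State.unprotNbrs_join_embedding e σ p c P hP hN]
      simpa [State.join] using hσ.searcher i
    · have h1 : (σ.join e p c P).pos (Fin.natAdd a i) = p i := by simp [State.join]
      rw [h1]
      simpa [State.join] using hmove i
  covers v hf u hu := by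
    by_cases hv : v ∈ Set.range e
    · obtain ⟨x, rfl⟩ := hv
      rw [State.fires_join_embedding e σ p c P hp hP hN] at hf
      rw [State.unprotNbrs_join_embedding e σ p c P hP hN] at hu
      obtain ⟨y, hy, rfl⟩ := hu
      obtain ⟨i, hi, rfl⟩ := hσ.covers x hf y hy
      rw [State.mobileAt_join_embedding e σ p c P hp]
      exact ⟨_, ⟨i, hi, rfl⟩, by simp [State.join]⟩
    · obtain ⟨i, hi, rfl⟩ := hcov v hv hf u hu
      rw [State.mobileAt_join_of_notMem e σ p c P hv]
      exact ⟨_, ⟨i, hi, rfl⟩, by simp [State.join]⟩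
  prot_eq := by
    have h : Set.range (Fin.append (e ∘ σ'.pos) p') = e '' Set.range σ'.pos ∪ Set.range p' := by
      rw [← Set.range_comp]
      ext v
      constructor
      · rintro ⟨i, rfl⟩
        refine Fin.addCases (fun i => ?_) (fun i => ?_) i
        · exact Or.inl ⟨i, by simp⟩
        · exact Or.inr ⟨i, by simp⟩
      · rintro (⟨i, rfl⟩ | ⟨i, rfl⟩)
        · exact ⟨Fin.castAdd ℓ i, by simp⟩
        · exact ⟨Fin.natAdd a i, by simp⟩
    simp only [State.join, hσ.prot_eq, hP', h, Set.image_union]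
    ext; simp only [Set.mem_union]; tauto

end Join

/-- Lets a finished embedded game idle while the sweep runs through its remaining phases. -/
theorem Stage.refl_of_prot_eq_univ {G : SimpleGraph V} {k : ℕ} {σ : State V ℓ}
    (h : σ.prot = Set.univ) : Stage G k σ σ where
  searcher _ := Or.inl ⟨rfl, rfl⟩
  covers v _ u hu := absurd (h ▸ Set.mem_univ u) hu.2
  prot_eq := by simp [h]

/-! ### Sweeps: teams that wait for the embedded game and then clear the rest. -/

/-- A sweep of the vertices outside the range of `e` in phases: `p b`, `c b`, `P b` are
the positions, the move counts and the protected vertices in phase `b`, and the vertices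
of `S b` fire when phase `b` ends. -/
structure Sweep {G : SimpleGraph V} {H : SimpleGraph W} (k : ℕ) (e : H ↪g G)
    (p : ℕ → Fin ℓ → V) (c : ℕ → Fin ℓ → ℕ) (P S : ℕ → Set V) (F : ℕ) : Prop where
  pos_notMem : ∀ b i, b ≤ F → p b i ∉ Set.range e
  prot_disjoint : ∀ b, b ≤ F → Disjoint (P b) (Set.range e)
  prot_nbrs : ∀ b x v, b ≤ F → G.Adj (e x) v → v ∉ Set.range e → v ∈ P b
  moves_zero : ∀ i, c 0 i = 0
  prot_zero : P 0 = Set.range (p 0)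
  prot_succ : ∀ b, b < F → P (b + 1) = P b ∪ Set.range (p (b + 1))
  prot_last : ∀ v, v ∉ Set.range e → v ∈ P F
  fire_notMem : ∀ b, b < F → ∀ v ∈ S b, v ∉ Set.range e
  /-- The vertices of `S b` have as many mobile searchers as unprotected neighbours off `e`. -/
  bijOn : ∀ b, b < F → ∀ v ∈ S b, Set.BijOn (p (b + 1)) {i | p b i = v ∧ c b i < k}
    {u | G.Adj v u ∧ u ∉ Set.range e ∧ u ∉ P b}
  moves_lt : ∀ b i, b < F → p b i ∈ S b → c b i < k
  moves_succ : ∀ b i, b < F → p b i ∈ S b → c (b + 1) i = c b i + 1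
  stay : ∀ b i, b < F → p b i ∉ S b → p (b + 1) i = p b i ∧ c (b + 1) i = c b i
  /-- Other vertices with mobile searchers have too many unprotected neighbours. -/
  blocked : ∀ b i, b < F → p b i ∉ S b → c b i < k →
    {j | p b j = p b i ∧ c b j < k}.ncard <
      {u | G.Adj (p b i) u ∧ u ∉ Set.range e ∧ u ∉ P b}.ncard
  /-- The vertices of `S b` wait for the same vertices of `e`. -/
  together : ∀ b, b < F → ∀ v ∈ S b, ∀ v' ∈ S b, ∀ x, G.Adj v (e x) →
    G.Adj v' (e x) ∨ ∃ b' < b, ∃ u ∈ S b', G.Adj u (e x)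
  last : ∀ i, c F i < k → ∀ x, ¬ G.Adj (p F i) (e x)

section Sweep

variable {G : SimpleGraph V} {H : SimpleGraph W} {k : ℕ} {e : H ↪g G}
  {p : ℕ → Fin ℓ → V} {c : ℕ → Fin ℓ → ℕ} {P S : ℕ → Set V} {F : ℕ}

/-- In phase `b`, the vertices of `e` next to those that have fired are protected. -/
def Awaited (e : H ↪g G) (S : ℕ → Set V) (σ : State W a) (b : ℕ) : Prop :=
  ∀ b' < b, ∀ u ∈ S b', ∀ x, G.Adj u (e x) → x ∈ σ.prot

theorem Awaited.mono {σ σ' : State W a} {b : ℕ} (h : Awaited e S σ b) (hσ : Stage H k σ σ') :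
    Awaited e S σ' b := fun b' hb u hu x hx => by
  rw [hσ.prot_eq]; exact Or.inl (h b' hb u hu x hx)

/-- The vertex `u` is needed because a vertex without unprotected neighbours fires vacuously.
Unprotected vertices of `e` only strengthen the blockade, so those off `e` are enough. -/
theorem Sweep.not_fires_of_blocked [Finite V] (hs : Sweep k e p c P S F) (σ : State W a) {b : ℕ}
    (hb : b < F) {v u : V} (hv : v ∉ Set.range e) (hvS : v ∉ S b)
    (hu : u ∈ (σ.join e (p b) (c b) (P b)).unprotNbrs G v) :
    ¬ (σ.join e (p b) (c b) (P b)).Fires G k v := by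
  rw [State.Fires, not_le, State.ncard_mobileAt_join_of_notMem e σ _ _ _ hv]
  by_cases hm : ∃ i, p b i = v ∧ c b i < k
  · obtain ⟨i, rfl, hi⟩ := hm
    refine (hs.blocked b i hb hvS hi).trans_le (Set.ncard_le_ncard ?_ (Set.toFinite _))
    exact fun u hu => (State.mem_unprotNbrs_join e σ _ _ _ hu.2.1).mpr ⟨hu.1, hu.2.2⟩
  · have : {i | p b i = v ∧ c b i < k} = ∅ :=
      Set.eq_empty_of_forall_notMem fun i hi => hm ⟨i, hi⟩
    rw [this, Set.ncard_empty, Set.ncard_pos (Set.toFinite _)]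
    exact ⟨u, hu⟩

theorem Sweep.unprotNbrs_of_ready (hs : Sweep k e p c P S F) (σ : State W a) {b : ℕ}
    (hb : b < F) {v : V} (hr : ∀ x, G.Adj v (e x) → x ∈ σ.prot) :
    (σ.join e (p b) (c b) (P b)).unprotNbrs G v =
      {u | G.Adj v u ∧ u ∉ Set.range e ∧ u ∉ P b} := by
  ext u
  by_cases hu : u ∈ Set.range e
  · obtain ⟨x, rfl⟩ := hu
    rw [State.mem_unprotNbrs_join_embedding e σ _ _ _ (hs.prot_disjoint b hb.le)]
    exact iff_of_false (fun h => h.2 (hr x h.1)) (fun h => h.2.1 ⟨x, rfl⟩)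
  · rw [State.mem_unprotNbrs_join e σ _ _ _ hu]
    simp only [Set.mem_ofPred_eq]; tauto

theorem Sweep.fires_of_ready (hs : Sweep k e p c P S F) (σ : State W a) {b : ℕ}
    (hb : b < F) {v : V} (hv : v ∈ S b) (hr : ∀ x, G.Adj v (e x) → x ∈ σ.prot) :
    (σ.join e (p b) (c b) (P b)).Fires G k v := by
  have h := hs.bijOn b hb v hv
  rw [State.Fires, hs.unprotNbrs_of_ready σ hb hr,
    State.ncard_mobileAt_join_of_notMem e σ _ _ _ (hs.fire_notMem b hb v hv), ← h.image_eq,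
    h.injOn.ncard_image]

/-- The bijection leaves no searcher to spare, so a single unprotected neighbour inside `e` tips the
count. -/
theorem Sweep.not_fires_of_not_ready [Finite V] (hs : Sweep k e p c P S F) (σ : State W a) {b : ℕ}
    (hb : b < F) {v : V} (hv : v ∈ S b) {x : W} (hx : G.Adj v (e x)) (hxσ : x ∉ σ.prot) :
    ¬ (σ.join e (p b) (c b) (P b)).Fires G k v := by
  have h := hs.bijOn b hb v hv
  rw [State.Fires, not_le,
    State.ncard_mobileAt_join_of_notMem e σ _ _ _ (hs.fire_notMem b hb v hv),
    ← h.injOn.ncard_image, h.image_eq]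
  refine Set.ncard_lt_ncard ⟨fun u hu => ?_, fun hsub => ?_⟩ (Set.toFinite _)
  · exact (State.mem_unprotNbrs_join e σ _ _ _ hu.2.1).mpr ⟨hu.1, hu.2.2⟩
  · exact (hsub ((State.mem_unprotNbrs_join_embedding e σ _ _ _
      (hs.prot_disjoint b hb.le)).mpr ⟨hx, hxσ⟩)).2.1 ⟨x, rfl⟩

theorem Sweep.stage_of_ready [Finite V] (hs : Sweep k e p c P S F) {σ σ' : State W a} {b : ℕ}
    (hb : b < F) (hσ : Stage H k σ σ') (hr : ∀ v ∈ S b, ∀ x, G.Adj v (e x) → x ∈ σ.prot) :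
    Stage G k (σ.join e (p b) (c b) (P b)) (σ'.join e (p (b + 1)) (c (b + 1)) (P (b + 1))) := by
  refine Stage.join e hσ (fun i => hs.pos_notMem b i hb.le) (hs.prot_disjoint b hb.le)
    (fun x v => hs.prot_nbrs b x v hb.le) (fun i => ?_) (fun v hv hf u hu => ?_) (hs.prot_succ b hb)
  · by_cases hi : p b i ∈ S b
    · refine Or.inr ⟨hs.fires_of_ready σ hb hi (hr _ hi), hs.moves_lt b i hb hi, ?_,
        hs.moves_succ b i hb hi⟩
      rw [hs.unprotNbrs_of_ready σ hb (hr _ hi)]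
      exact (hs.bijOn b hb _ hi).mapsTo ⟨rfl, hs.moves_lt b i hb hi⟩
    · exact Or.inl (hs.stay b i hb hi)
  · by_cases hvS : v ∈ S b
    · rw [hs.unprotNbrs_of_ready σ hb (hr _ hvS)] at hu
      exact (hs.bijOn b hb _ hvS).surjOn hu
    · exact absurd hf (hs.not_fires_of_blocked σ hb hv hvS hu)

theorem Sweep.range_subset (hs : Sweep k e p c P S F) {b : ℕ} (hb : b ≤ F) :
    Set.range (p b) ⊆ P b := by
  cases b with
  | zero => exact hs.prot_zero.ge
  | succ b => rw [hs.prot_succ b hb]; exact Set.subset_union_right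

/-- During each stage of the embedded game the sweep either advances by one phase, if everything it
waits for is protected, or stands still as a whole. -/
theorem Sweep.exists_stage [Finite V] (hs : Sweep k e p c P S F) {σ σ' : State W a} {b : ℕ}
    (hb : b ≤ F) (haw : Awaited e S σ b) (hσ : Stage H k σ σ') :
    ∃ b' ≤ F, Awaited e S σ' b' ∧
      Stage G k (σ.join e (p b) (c b) (P b)) (σ'.join e (p b') (c b') (P b')) := by
  have hrange : P b = P b ∪ Set.range (p b) := (Set.union_eq_left.mpr (hs.range_subset hb)).symm
  obtain rfl | hb := hb.eq_or_lt
  · refine ⟨b, le_rfl, haw.mono hσ, Stage.join e hσ (fun i => hs.pos_notMem b i le_rfl)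
      (hs.prot_disjoint b le_rfl) (fun x v => hs.prot_nbrs b x v le_rfl) (fun i => Or.inl ⟨rfl, rfl⟩)
      (fun v hv hf u hu => ?_) hrange⟩
    exfalso
    by_cases hue : u ∈ Set.range e
    · have hpos := (Set.ncard_pos (Set.toFinite _)).mpr ⟨u, hu⟩
      have hpos := hpos.trans_le hf
      rw [State.ncard_mobileAt_join_of_notMem e σ _ _ _ hv, Set.ncard_pos (Set.toFinite _)] at hpos
      obtain ⟨i, rfl, hi⟩ := hpos
      obtain ⟨x, rfl⟩ := hue
      exact hs.last i hi x hu.1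
    · exact hu.2 (Or.inr (hs.prot_last u hue))
  by_cases hr : ∀ v ∈ S b, ∀ x, G.Adj v (e x) → x ∈ σ.prot
  · refine ⟨b + 1, hb, fun b' hb' u hu x hx => ?_, hs.stage_of_ready hb hσ hr⟩
    obtain hb' | rfl := (Nat.lt_succ_iff.mp hb').lt_or_eq
    · exact haw.mono hσ b' hb' u hu x hx
    · rw [hσ.prot_eq]; exact Or.inl (hr u hu x hx)
  · push Not at hr
    obtain ⟨v₀, hv₀, x, hx, hxσ⟩ := hr
    refine ⟨b, hb.le, haw.mono hσ, Stage.join e hσ (fun i => hs.pos_notMem b i hb.le)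
      (hs.prot_disjoint b hb.le) (fun x v => hs.prot_nbrs b x v hb.le) (fun i => Or.inl ⟨rfl, rfl⟩)
      (fun v hv hf u hu => ?_) hrange⟩
    exfalso
    by_cases hvS : v ∈ S b
    · refine hs.not_fires_of_not_ready σ hb hvS ?_ hxσ hf
      -- A vertex of `S b` must not fire while another one waits: the missing vertex `x` also blocks
      -- `v`, unless an earlier phase has already awaited it, and then it would be protected.
      obtain h | ⟨b', hb', u, hu, h⟩ := hs.together b hb v₀ hv₀ v hvS x hx
      · exact h
      · exact absurd (haw b' hb' u hu x h) hxσ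
    · exact hs.not_fires_of_blocked σ hb hv hvS hu hf

theorem Sweep.isSuccessful [Finite V] (hs : Sweep k e p c P S F) {L : Fin a → W}
    (hL : IsSuccessful H k L) : IsSuccessful G k (Fin.append (e ∘ L) (p 0)) := by
  obtain ⟨τ, hτ, hτu⟩ := hL
  have hinit : State.init (Fin.append (e ∘ L) (p 0)) =
      (State.init L).join e (p 0) (c 0) (P 0) := by
    simp only [State.init, State.join, State.mk.injEq, true_and]
    constructor
    · ext i
      refine Fin.addCases (fun i => ?_) (fun i => ?_) i <;> simp [hs.moves_zero]
    · rw [hs.prot_zero, ← Set.range_comp]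
      ext v
      constructor
      · rintro ⟨i, rfl⟩
        refine Fin.addCases (fun i => ?_) (fun i => ?_) i
        · exact Or.inl ⟨i, by simp⟩
        · exact Or.inr ⟨i, by simp⟩
      · rintro (⟨i, rfl⟩ | ⟨i, rfl⟩)
        · exact ⟨Fin.castAdd ℓ i, by simp⟩
        · exact ⟨Fin.natAdd a i, by simp⟩
  have h1 : ∃ b ≤ F, Awaited e S τ b ∧ Relation.ReflTransGen (Stage G k)
      ((State.init L).join e (p 0) (c 0) (P 0)) (τ.join e (p b) (c b) (P b)) := by
    clear hτu
    induction hτ with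
    | refl => exact ⟨0, Nat.zero_le _, fun b' hb' => absurd hb' (Nat.not_lt_zero _), .refl⟩
    | tail _ hstage ih =>
      obtain ⟨b, hb, haw, hr⟩ := ih
      obtain ⟨b', hb', haw', hst⟩ := hs.exists_stage hb haw hstage
      exact ⟨b', hb', haw', hr.tail hst⟩
  obtain ⟨b, hb, -, hr⟩ := h1
  -- With the embedded game over, every later phase is ready at once.
  have h2 : ∀ d b, b + d = F → Relation.ReflTransGen (Stage G k)
      (τ.join e (p b) (c b) (P b)) (τ.join e (p F) (c F) (P F)) := by
    intro d
    induction d with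
    | zero => rintro b rfl; exact .refl
    | succ d ih =>
      intro b hbd
      exact .head (hs.stage_of_ready (by omega) (Stage.refl_of_prot_eq_univ hτu)
        fun _ _ x _ => hτu ▸ Set.mem_univ x) (ih (b + 1) (by omega))
  refine ⟨_, hinit ▸ hr.trans (h2 (F - b) b (by omega)), Set.eq_univ_of_forall fun v => ?_⟩
  by_cases hv : v ∈ Set.range e
  · obtain ⟨x, rfl⟩ := hv
    exact Or.inl ⟨x, hτu ▸ Set.mem_univ x, rfl⟩
  · exact Or.inr (hs.prot_last v hv)

theorem Sweep.deductionNumber_le [Finite V] [Finite W] (hs : Sweep k e p c P S F) :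
    G.deductionNumber k ≤ H.deductionNumber k + ℓ := by
  obtain ⟨L, hL⟩ := H.exists_isSuccessful_deductionNumber k
  exact Nat.sInf_le ⟨_, hs.isSuccessful hL⟩

end Sweep

/-- An isomorphism leaves nothing to sweep, so a team of no searchers with no phases will do. -/
theorem deductionNumber_le_of_iso {G : SimpleGraph V} {H : SimpleGraph W} [Finite V] [Finite W]
    (k : ℕ) (e : H ≃g G) : G.deductionNumber k ≤ H.deductionNumber k := by
  have hr : ∀ v, v ∈ Set.range e.toEmbedding := e.surjective
  have hs : Sweep (ℓ := 0) k e.toEmbedding (fun _ => Fin.elim0) (fun _ => Fin.elim0)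
      (fun _ => ∅) (fun _ => ∅) 0 := by
    constructor <;> simp
  exact hs.deductionNumber_le

end Deduction

/-! ### Coordinates in strong grids. -/

open SimpleGraph

theorem SimpleGraph.strongProd_pathGraph_adj {m n : ℕ} {x y : Fin m × Fin n} :
    ((pathGraph m).strongProd (pathGraph n)).Adj x y ↔
      ¬ ((x.1 : ℕ) = y.1 ∧ (x.2 : ℕ) = y.2) ∧ (x.1 : ℕ) ≤ y.1 + 1 ∧ (y.1 : ℕ) ≤ x.1 + 1 ∧
        (x.2 : ℕ) ≤ y.2 + 1 ∧ (y.2 : ℕ) ≤ x.2 + 1 := by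
  simp only [strongProd, boxProd_adj, pathGraph_adj, Fin.ext_iff]
  omega

/-- The first `N` rows of a strong grid with `N + h` rows. -/
def SimpleGraph.rowsEmbedding (N h w : ℕ) :
    (pathGraph N).strongProd (pathGraph w) ↪g (pathGraph (N + h)).strongProd (pathGraph w) where
  toFun x := (Fin.castAdd h x.1, x.2)
  inj' x y hxy := by
    simp only [Prod.mk.injEq, Fin.castAdd_inj] at hxy
    exact Prod.ext hxy.1 hxy.2
  map_rel_iff' {x y} := (strongProd_pathGraph_adj (x := (Fin.castAdd h x.1, x.2))
    (y := (Fin.castAdd h y.1, y.2))).trans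
    (strongProd_pathGraph_adj (x := x) (y := y)).symm

theorem SimpleGraph.notMem_range_rowsEmbedding {N h w : ℕ} {v : Fin (N + h) × Fin w} :
    v ∉ Set.range (rowsEmbedding N h w) ↔ N ≤ v.1 := by
  rw [← not_lt, not_iff_not]
  constructor
  · rintro ⟨x, rfl⟩
    exact x.1.isLt
  · exact fun hv => ⟨(⟨v.1, hv⟩, v.2), rfl⟩

theorem SimpleGraph.adj_rowsEmbedding {N h w : ℕ} {v : Fin (N + h) × Fin w} {x : Fin N × Fin w}
    (hv : N ≤ v.1) :
    ((pathGraph (N + h)).strongProd (pathGraph w)).Adj v (rowsEmbedding N h w x) ↔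
      (v.1 : ℕ) ≤ x.1 + 1 ∧ (v.2 : ℕ) ≤ x.2 + 1 ∧ (x.2 : ℕ) ≤ v.2 + 1 := by
  have := x.1.isLt
  have he : rowsEmbedding N h w x = (Fin.castAdd h x.1, x.2) := rfl
  simp only [he, strongProd_pathGraph_adj, Fin.val_castAdd]
  omega

namespace Deduction

/-- Vertex in row `x` and column `y` of a nonempty grid. -/
def gridVertex (m n : ℕ) [NeZero m] [NeZero n] (x y : ℕ) : Fin m × Fin n :=
  (Fin.ofNat m x, Fin.ofNat n y)

theorem gridVertex_eq_iff {m n : ℕ} [NeZero m] [NeZero n] {x y : ℕ} (hx : x < m) (hy : y < n)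
    {v : Fin m × Fin n} : gridVertex m n x y = v ↔ x = v.1 ∧ y = v.2 := by
  simp [gridVertex, Prod.ext_iff, Fin.ext_iff, Nat.mod_eq_of_lt hx, Nat.mod_eq_of_lt hy]

theorem gridVertex_fst {m n : ℕ} [NeZero m] [NeZero n] {x y : ℕ} (hx : x < m) :
    ((gridVertex m n x y).1 : ℕ) = x := by
  simp [gridVertex, Nat.mod_eq_of_lt hx]

theorem gridVertex_snd {m n : ℕ} [NeZero m] [NeZero n] {x y : ℕ} (hy : y < n) :
    ((gridVertex m n x y).2 : ℕ) = y := by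
  simp [gridVertex, Nat.mod_eq_of_lt hy]

/-! ### Arithmetic of the snake: `w + 1` searchers crossing from one row to the next. -/

section Snake

/-- Labels of searchers, read backwards in odd rows. -/
def flipLabel (w j i : ℕ) : ℕ := if j % 2 = 0 then i else w - i

/-- Columns, read backwards in odd rows. -/
def flipCol (w j y : ℕ) : ℕ := if j % 2 = 0 then y else w - 1 - y

/-- Row of searcher `i` after `t` steps from row `j` to row `j + 1`. -/
def snakeRow (w j t i : ℕ) : ℕ := if min (flipLabel w j i - 1) (w - 2) < t then j + 1 else j

/-- Column of searcher `i` after `t` steps from row `j` to row `j + 1`. -/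
def snakeCol (w j t i : ℕ) : ℕ :=
  flipCol w j (if min (flipLabel w j i - 1) (w - 2) < t then min (flipLabel w j i) (w - 1)
    else flipLabel w j i - 1)

/-- The vertices protected after `t` steps from row `j` to row `j + 1`. -/
def SnakeProt (w j t x y : ℕ) : Prop := x ≤ j ∨ (x = j + 1 ∧ flipCol w j y - 1 < t)

/-- The vertices that fire after `t` steps from row `j` to row `j + 1`. -/
def SnakeFire (w j t x y : ℕ) : Prop :=
  x = j ∧ (flipCol w j y = t ∨ (t = w - 2 ∧ flipCol w j y = w - 1))

variable {w j t : ℕ}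

theorem flipCol_lt {y : ℕ} (hy : y < w) : flipCol w j y < w := by
  unfold flipCol; split_ifs <;> omega

theorem flipCol_flipCol {y : ℕ} (hy : y < w) : flipCol w j (flipCol w j y) = y := by
  unfold flipCol; split_ifs <;> omega

theorem flipLabel_le {i : ℕ} (hi : i ≤ w) : flipLabel w j i ≤ w := by
  unfold flipLabel; split_ifs <;> omega

theorem flipLabel_flipLabel {i : ℕ} (hi : i ≤ w) : flipLabel w j (flipLabel w j i) = i := by
  unfold flipLabel; split_ifs <;> omega

/-- Reflection preserves adjacency of columns, so odd rows reduce to even ones. -/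
theorem flipCol_le_succ_iff {y z : ℕ} (hy : y < w) (hz : z < w) :
    (flipCol w j y ≤ flipCol w j z + 1 ∧ flipCol w j z ≤ flipCol w j y + 1) ↔
      (y ≤ z + 1 ∧ z ≤ y + 1) := by
  unfold flipCol; split_ifs <;> omega

theorem flipCol_snakeCol {i : ℕ} (hw : 3 ≤ w) (hi : i ≤ w) : flipCol w j (snakeCol w j t i) =
    if min (flipLabel w j i - 1) (w - 2) < t then min (flipLabel w j i) (w - 1)
      else flipLabel w j i - 1 := by
  have := flipLabel_le (j := j) hi
  rw [snakeCol, flipCol_flipCol]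
  split_ifs <;> omega

theorem snakeCol_lt {i : ℕ} (hw : 3 ≤ w) (hi : i ≤ w) : snakeCol w j t i < w := by
  have := flipLabel_le (j := j) hi
  refine flipCol_lt ?_
  split_ifs <;> omega

theorem snakeRow_last {i : ℕ} (hw : 3 ≤ w) : snakeRow w j (w - 1) i = snakeRow w (j + 1) 0 i := by
  unfold snakeRow
  rw [if_pos (by omega), if_neg (by omega)]

/-- In reflected labels, `w - 1` and `w` have met in the last column. Reversal turns them into 1 and
0, which share the first column through truncated subtraction. -/
theorem snakeCol_last {i : ℕ} (hw : 3 ≤ w) (hi : i ≤ w) :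
    snakeCol w j (w - 1) i = snakeCol w (j + 1) 0 i := by
  unfold snakeCol
  rw [if_pos (by omega), if_neg (by omega)]
  unfold flipCol flipLabel
  split_ifs <;> omega

theorem snakeProt_last {x y : ℕ} (hw : 3 ≤ w) (hy : y < w) :
    SnakeProt w j (w - 1) x y ↔ SnakeProt w (j + 1) 0 x y := by
  have := flipCol_lt (j := j) hy
  unfold SnakeProt
  omega

theorem snakeProt_succ {x y : ℕ} (hw : 3 ≤ w) (hy : y < w) :
    SnakeProt w j (t + 1) x y ↔ SnakeProt w j t x y ∨
      ∃ i ≤ w, snakeRow w j (t + 1) i = x ∧ snakeCol w j (t + 1) i = y := by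
  have hf := flipCol_lt (j := j) hy
  constructor
  · rintro (h | ⟨h, h'⟩)
    · exact Or.inl (Or.inl h)
    · by_cases ht : flipCol w j y - 1 < t
      · exact Or.inl (Or.inr ⟨h, ht⟩)
      · refine Or.inr ⟨flipLabel w j (flipCol w j y), flipLabel_le hf.le, ?_, ?_⟩
        · rw [snakeRow, flipLabel_flipLabel hf.le, if_pos (by omega), h]
        · rw [snakeCol, flipLabel_flipLabel hf.le, if_pos (by omega), min_eq_left (by omega),
            flipCol_flipCol hy]
  · rintro (h | ⟨i, hi, rfl, rfl⟩)
    · unfold SnakeProt at *; omega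
    · have := flipLabel_le (j := j) hi
      rw [SnakeProt, flipCol_snakeCol hw hi, snakeRow]
      split_ifs <;> omega

theorem snakeProt_zero {x y : ℕ} (hy : y < w) :
    SnakeProt w 0 0 x y ↔ ∃ i ≤ w, snakeRow w 0 0 i = x ∧ snakeCol w 0 0 i = y := by
  simp only [SnakeProt, snakeRow, snakeCol, flipCol, flipLabel, Nat.zero_mod, if_true, not_lt_zero,
    if_false]
  constructor
  · intro h
    exact ⟨y + 1, hy, by simpa [eq_comm] using h, by omega⟩
  · rintro ⟨i, -, h, -⟩
    omega

/-- A searcher on a firing vertex moves to the next row, to an unprotected neighbour. -/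
theorem snake_fire_mapsTo {i : ℕ} (hw : 3 ≤ w) (ht : t < w - 1) (hi : i ≤ w)
    (h : SnakeFire w j t (snakeRow w j t i) (snakeCol w j t i)) :
    snakeRow w j t i = j ∧ snakeRow w j (t + 1) i = j + 1 ∧
      (snakeCol w j t i ≤ snakeCol w j (t + 1) i + 1 ∧
        snakeCol w j (t + 1) i ≤ snakeCol w j t i + 1) ∧
      ¬ SnakeProt w j t (snakeRow w j (t + 1) i) (snakeCol w j (t + 1) i) := by
  have hl := flipLabel_le (j := j) hi
  obtain ⟨h1, h2⟩ := h
  have h3 : ¬ min (flipLabel w j i - 1) (w - 2) < t := fun h => by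
    rw [snakeRow, if_pos h] at h1; omega
  rw [flipCol_snakeCol hw hi, if_neg h3] at h2
  have h4 : min (flipLabel w j i - 1) (w - 2) < t + 1 := by omega
  rw [← flipCol_le_succ_iff (j := j) (snakeCol_lt hw hi) (snakeCol_lt hw hi), SnakeProt,
    flipCol_snakeCol hw hi, flipCol_snakeCol hw hi, snakeRow, snakeRow, if_neg h3, if_pos h4,
    if_neg h3, if_pos h4]
  omega

theorem snake_fire_injOn {i i' : ℕ} (hw : 3 ≤ w) (ht : t < w - 1) (hi : i ≤ w) (hi' : i' ≤ w)
    (h : SnakeFire w j t (snakeRow w j t i) (snakeCol w j t i))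
    (hr : snakeRow w j t i' = snakeRow w j t i) (hc : snakeCol w j t i' = snakeCol w j t i)
    (hc' : snakeCol w j (t + 1) i = snakeCol w j (t + 1) i') : i = i' := by
  have hl := flipLabel_le (j := j) hi
  have hl' := flipLabel_le (j := j) hi'
  have h' : SnakeFire w j t (snakeRow w j t i') (snakeCol w j t i') := by rwa [hr, hc]
  obtain ⟨h1, h2⟩ := h
  obtain ⟨h1', h2'⟩ := h'
  have h3 : ¬ min (flipLabel w j i - 1) (w - 2) < t := fun h => by
    rw [snakeRow, if_pos h] at h1; omega
  have h3' : ¬ min (flipLabel w j i' - 1) (w - 2) < t := fun h => by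
    rw [snakeRow, if_pos h] at h1'; omega
  have hc := congrArg (flipCol w j) hc
  have hc' := congrArg (flipCol w j) hc'
  rw [flipCol_snakeCol hw hi, if_neg h3] at h2 hc
  rw [flipCol_snakeCol hw hi', if_neg h3'] at h2' hc
  rw [flipCol_snakeCol hw hi, flipCol_snakeCol hw hi', if_pos (by omega), if_pos (by omega)] at hc'
  rw [← flipLabel_flipLabel (j := j) hi, ← flipLabel_flipLabel (j := j) hi']
  congr 1
  omega

theorem snake_fire_surjOn {x y u : ℕ} (hw : 3 ≤ w) (ht : t < w - 1) (hy : y < w) (hu : u < w)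
    (h : SnakeFire w j t x y) (hyu : y ≤ u + 1 ∧ u ≤ y + 1) (hup : ¬ SnakeProt w j t (j + 1) u) :
    ∃ i ≤ w, snakeRow w j t i = x ∧ snakeCol w j t i = y ∧ snakeCol w j (t + 1) i = u := by
  have hfu := flipCol_lt (j := j) hu
  have hfy := flipCol_lt (j := j) hy
  rw [← flipCol_le_succ_iff (j := j) hy hu] at hyu
  obtain ⟨rfl, h⟩ := h
  simp only [SnakeProt, true_and, not_or] at hup
  have key : ∀ l ≤ w, l - 1 = flipCol w x y → min l (w - 1) = flipCol w x u →
      ∃ i ≤ w, snakeRow w x t i = x ∧ snakeCol w x t i = y ∧ snakeCol w x (t + 1) i = u := by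
    intro l hl h1 h2
    refine ⟨flipLabel w x l, flipLabel_le hl, ?_, ?_, ?_⟩
    · rw [snakeRow, flipLabel_flipLabel hl, if_neg (by omega)]
    · rw [snakeCol, flipLabel_flipLabel hl, if_neg (by omega), h1, flipCol_flipCol hy]
    · rw [snakeCol, flipLabel_flipLabel hl, if_pos (by omega), h2, flipCol_flipCol hu]
  -- The doubled end sends labels 0 and 1 to columns 0 and 1; any later firing column holds one
  -- searcher, whose label is one more than its column.
  by_cases h0 : t = 0
  · exact key (flipCol w x u) hfu.le (by omega) (by omega)
  · exact key (flipCol w x y + 1) hfy (by omega) (by omega)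

theorem snake_stay {i : ℕ} (hw : 3 ≤ w) (ht : t < w - 1) (hi : i ≤ w)
    (h : ¬ SnakeFire w j t (snakeRow w j t i) (snakeCol w j t i)) :
    snakeRow w j (t + 1) i = snakeRow w j t i ∧ snakeCol w j (t + 1) i = snakeCol w j t i := by
  have hl := flipLabel_le (j := j) hi
  have h1 : min (flipLabel w j i - 1) (w - 2) < t + 1 ↔ min (flipLabel w j i - 1) (w - 2) < t := by
    refine ⟨fun h1 => ?_, fun h => by omega⟩
    by_contra h2
    refine h ⟨by rw [snakeRow, if_neg h2], ?_⟩
    rw [flipCol_snakeCol hw hi, if_neg h2]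
    omega
  simp only [snakeRow, snakeCol, h1, and_self]

/-- Before the row is complete, the only shared vertex is the doubled end, which fires at `t = 0`.
-/
theorem snake_blocked_unique {i i' : ℕ} (hw : 3 ≤ w) (ht : t < w - 1) (hi : i ≤ w) (hi' : i' ≤ w)
    (h : ¬ SnakeFire w j t (snakeRow w j t i) (snakeCol w j t i))
    (hr : snakeRow w j t i' = snakeRow w j t i) (hc : snakeCol w j t i' = snakeCol w j t i) :
    i' = i := by
  have hl := flipLabel_le (j := j) hi
  have hl' := flipLabel_le (j := j) hi'
  have hc := congrArg (flipCol w j) hc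
  rw [SnakeFire] at h
  rw [flipCol_snakeCol hw hi] at hc h
  rw [flipCol_snakeCol hw hi'] at hc
  rw [← flipLabel_flipLabel (j := j) hi, ← flipLabel_flipLabel (j := j) hi']
  congr 1
  unfold snakeRow at *
  split_ifs at * <;> omega

/-- A searcher still waiting in row `j` is ahead of the protected part of the next row, and one that
has moved faces an untouched row. With uniqueness, this gives one searcher against at least two
neighbours. -/
theorem snake_blocked_unprot {i : ℕ} (hw : 3 ≤ w) (ht : t < w - 1) (hi : i ≤ w)
    (h : ¬ SnakeFire w j t (snakeRow w j t i) (snakeCol w j t i)) :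
    ¬ SnakeProt w j t (snakeRow w j t i + 1) (snakeCol w j t i) ∧
      ∃ y < w, y ≠ snakeCol w j t i ∧ (snakeCol w j t i ≤ y + 1 ∧ y ≤ snakeCol w j t i + 1) ∧
        ¬ SnakeProt w j t (snakeRow w j t i + 1) y := by
  have hl := flipLabel_le (j := j) hi
  have hc := snakeCol_lt (j := j) (t := t) hw hi
  have hfc := flipCol_lt (j := j) hc
  have key : ∀ z < w, z ≠ flipCol w j (snakeCol w j t i) →
      (flipCol w j (snakeCol w j t i) ≤ z + 1 ∧ z ≤ flipCol w j (snakeCol w j t i) + 1) →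
      ¬ (snakeRow w j t i ≤ j ∧ z - 1 < t) →
      ∃ y < w, y ≠ snakeCol w j t i ∧ (snakeCol w j t i ≤ y + 1 ∧ y ≤ snakeCol w j t i + 1) ∧
        ¬ SnakeProt w j t (snakeRow w j t i + 1) y := by
    intro z hz hne hadj hp
    have hr : j ≤ snakeRow w j t i := by unfold snakeRow; split_ifs <;> omega
    refine ⟨flipCol w j z, flipCol_lt hz, ?_, ?_, ?_⟩
    · intro h; rw [← h, flipCol_flipCol hz] at hne; exact hne rfl
    · rwa [← flipCol_le_succ_iff (j := j) hc (flipCol_lt hz), flipCol_flipCol hz]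
    · rw [SnakeProt, flipCol_flipCol hz]; omega
  rw [SnakeFire] at h
  constructor
  · rw [SnakeProt]
    rw [flipCol_snakeCol hw hi] at h ⊢
    unfold snakeRow at *
    split_ifs at * <;> omega
  · by_cases hz : flipCol w j (snakeCol w j t i) + 1 < w
    · refine key _ hz (by omega) (by omega) ?_
      rw [flipCol_snakeCol hw hi] at h ⊢
      unfold snakeRow at *
      split_ifs at * <;> omega
    · refine key (flipCol w j (snakeCol w j t i) - 1) (by omega) (by omega) (by omega) ?_
      rw [flipCol_snakeCol hw hi] at *
      unfold snakeRow at *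
      split_ifs at * <;> omega

end Snake

end Deduction

/-! ### Clearing `k + 1` rows of width at least 3. -/

namespace Deduction

/-- Phase `b` is step `b % (w - 1)` of row `b / (w - 1)`. Each searcher moves once per row, so its
relative row is also its move count. -/
theorem sweep_snake (k N w : ℕ) (hw : 3 ≤ w) [NeZero (N + (k + 1))] [NeZero w] :
    Sweep (ℓ := w + 1) k (rowsEmbedding N (k + 1) w)
      (fun b i => gridVertex (N + (k + 1)) w (N + snakeRow w (b / (w - 1)) (b % (w - 1)) i)
        (snakeCol w (b / (w - 1)) (b % (w - 1)) i))
      (fun b i => snakeRow w (b / (w - 1)) (b % (w - 1)) i)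
      (fun b => {v | N ≤ v.1 ∧ SnakeProt w (b / (w - 1)) (b % (w - 1)) (v.1 - N) v.2})
      (fun b => {v | N ≤ v.1 ∧ SnakeFire w (b / (w - 1)) (b % (w - 1)) (v.1 - N) v.2})
      (k * (w - 1)) := by
  have hT : 0 < w - 1 := by omega
  have hdiv : ∀ {b}, b < k * (w - 1) → b / (w - 1) < k := fun hb => (Nat.div_lt_iff_lt_mul hT).2 hb
  have hmod : ∀ b, b % (w - 1) < w - 1 := fun b => Nat.mod_lt _ hT
  have hlast : k * (w - 1) / (w - 1) = k := Nat.mul_div_cancel _ hT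
  have hlast' : k * (w - 1) % (w - 1) = 0 := Nat.mul_mod_left _ _
  have hi' : ∀ i : Fin (w + 1), (i : ℕ) ≤ w := fun i => Nat.lt_succ_iff.mp i.isLt
  have hrow : ∀ {b} (i : ℕ), b ≤ k * (w - 1) →
      snakeRow w (b / (w - 1)) (b % (w - 1)) i ≤ k := by
    intro b i hb
    obtain rfl | hb := hb.eq_or_lt
    · simp [hlast, hlast', snakeRow]
    · have := hdiv hb
      unfold snakeRow; split_ifs <;> omega
  have hsucc : ∀ b, ((b + 1) / (w - 1) = b / (w - 1) ∧ (b + 1) % (w - 1) = b % (w - 1) + 1) ∨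
      ((b + 1) / (w - 1) = b / (w - 1) + 1 ∧ (b + 1) % (w - 1) = 0 ∧
        b % (w - 1) + 1 = w - 1) := by
    intro b
    have h1 := hmod b
    have h2 := Nat.div_add_mod b (w - 1)
    obtain h | h := lt_or_eq_of_le (show b % (w - 1) + 1 ≤ w - 1 from h1)
    · left
      have : b + 1 = (b % (w - 1) + 1) + (w - 1) * (b / (w - 1)) := by omega
      constructor
      · rw [this, Nat.add_mul_div_left _ _ hT, Nat.div_eq_of_lt h, Nat.zero_add]
      · rw [this, Nat.add_mul_mod_self_left, Nat.mod_eq_of_lt h]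
    · right
      have : b + 1 = (w - 1) * (b / (w - 1) + 1) := by rw [Nat.mul_add]; omega
      refine ⟨?_, ?_, h⟩
      · rw [this, Nat.mul_div_cancel_left _ hT]
      · rw [this, Nat.mul_mod_right]
  have hsr : ∀ b i, snakeRow w ((b + 1) / (w - 1)) ((b + 1) % (w - 1)) i =
      snakeRow w (b / (w - 1)) (b % (w - 1) + 1) i := by
    intro b i
    obtain ⟨h1, h2⟩ | ⟨h1, h2, h3⟩ := hsucc b
    · rw [h1, h2]
    · rw [h1, h2, h3, snakeRow_last hw]
  have hsc : ∀ b i, i ≤ w → snakeCol w ((b + 1) / (w - 1)) ((b + 1) % (w - 1)) i =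
      snakeCol w (b / (w - 1)) (b % (w - 1) + 1) i := by
    intro b i hi
    obtain ⟨h1, h2⟩ | ⟨h1, h2, h3⟩ := hsucc b
    · rw [h1, h2]
    · rw [h1, h2, h3, snakeCol_last hw hi]
  have hsp : ∀ b x y, y < w → (SnakeProt w ((b + 1) / (w - 1)) ((b + 1) % (w - 1)) x y ↔
      SnakeProt w (b / (w - 1)) (b % (w - 1) + 1) x y) := by
    intro b x y hy
    obtain ⟨h1, h2⟩ | ⟨h1, h2, h3⟩ := hsucc b
    · rw [h1, h2]
    · rw [h1, h2, h3, snakeProt_last hw hy]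
  have heq : ∀ {b} (i : Fin (w + 1)) (v : Fin (N + (k + 1)) × Fin w), b ≤ k * (w - 1) →
      (gridVertex (N + (k + 1)) w (N + snakeRow w (b / (w - 1)) (b % (w - 1)) i)
        (snakeCol w (b / (w - 1)) (b % (w - 1)) i) = v ↔
      N + snakeRow w (b / (w - 1)) (b % (w - 1)) i = v.1 ∧
        snakeCol w (b / (w - 1)) (b % (w - 1)) i = v.2) := by
    intro b i v hb
    have := hrow i hb
    exact gridVertex_eq_iff (by omega) (snakeCol_lt hw (hi' i))
  have hfst : ∀ {b} (i : Fin (w + 1)), b ≤ k * (w - 1) →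
      ((gridVertex (N + (k + 1)) w (N + snakeRow w (b / (w - 1)) (b % (w - 1)) i)
        (snakeCol w (b / (w - 1)) (b % (w - 1)) i)).1 : ℕ) =
      N + snakeRow w (b / (w - 1)) (b % (w - 1)) i := by
    intro b i hb
    have := hrow i hb
    exact gridVertex_fst (by omega)
  have hsnd : ∀ {b} (i : Fin (w + 1)),
      ((gridVertex (N + (k + 1)) w (N + snakeRow w (b / (w - 1)) (b % (w - 1)) i)
        (snakeCol w (b / (w - 1)) (b % (w - 1)) i)).2 : ℕ) =
      snakeCol w (b / (w - 1)) (b % (w - 1)) i :=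
    fun i => gridVertex_snd (snakeCol_lt hw (hi' i))
  have hS : ∀ {b} (i : Fin (w + 1)), b ≤ k * (w - 1) →
      (gridVertex (N + (k + 1)) w (N + snakeRow w (b / (w - 1)) (b % (w - 1)) i)
        (snakeCol w (b / (w - 1)) (b % (w - 1)) i) ∈
          {v : Fin (N + (k + 1)) × Fin w |
            N ≤ v.1 ∧ SnakeFire w (b / (w - 1)) (b % (w - 1)) (v.1 - N) v.2} ↔
        SnakeFire w (b / (w - 1)) (b % (w - 1)) (snakeRow w (b / (w - 1)) (b % (w - 1)) i)
          (snakeCol w (b / (w - 1)) (b % (w - 1)) i)) := by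
    intro b i hb
    rw [Set.mem_ofPred_eq, hfst i hb, hsnd, Nat.add_sub_cancel_left]
    simp
  constructor
  · intro b i hb
    rw [notMem_range_rowsEmbedding, hfst i hb]
    omega
  · intro b hb
    rw [Set.disjoint_left]
    exact fun v hv => notMem_range_rowsEmbedding.2 hv.1
  · intro b x v hb hadj hv
    rw [notMem_range_rowsEmbedding] at hv
    have h1 := (adj_rowsEmbedding hv).1 hadj.symm
    have h2 := x.1.isLt
    exact ⟨hv, Or.inl (le_of_eq_of_le (by omega : (v.1 : ℕ) - N = 0) (Nat.zero_le _))⟩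
  · intro i
    simp [snakeRow]
  · ext v
    simp only [Set.mem_ofPred_eq, Set.mem_range, heq _ _ (Nat.zero_le _)]
    rw [Nat.zero_div, Nat.zero_mod, snakeProt_zero v.2.isLt]
    constructor
    · rintro ⟨hv, i, hi, h1, h2⟩
      exact ⟨⟨i, Nat.lt_succ_iff.mpr hi⟩, by simp only [h1]; omega, h2⟩
    · rintro ⟨i, h1, h2⟩
      exact ⟨by omega, i, hi' i, by omega, h2⟩
  · intro b hb
    ext v
    simp only [Set.mem_ofPred_eq, Set.mem_range, Set.mem_union, heq _ _ (Nat.succ_le_of_lt hb)]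
    rw [hsp b _ _ v.2.isLt, snakeProt_succ hw v.2.isLt]
    constructor
    · rintro ⟨hv, h | ⟨i, hi, h1, h2⟩⟩
      · exact Or.inl ⟨hv, h⟩
      · refine Or.inr ⟨⟨i, Nat.lt_succ_iff.mpr hi⟩, ?_, ?_⟩
        · simp only [hsr, h1]; omega
        · simpa only [hsc b i hi] using h2
    · rintro (⟨hv, h⟩ | ⟨i, h1, h2⟩)
      · exact ⟨hv, Or.inl h⟩
      · rw [hsr] at h1
        rw [hsc b i (hi' i)] at h2
        exact ⟨by omega, Or.inr ⟨i, hi' i, by omega, h2⟩⟩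
  · intro v hv
    rw [notMem_range_rowsEmbedding] at hv
    refine ⟨hv, Or.inl ?_⟩
    rw [hlast]
    omega
  · intro b hb v hv
    exact notMem_range_rowsEmbedding.2 hv.1
  · rintro b hb v ⟨hv, hvS⟩
    have hrowlt := hdiv hb
    have hmem : ∀ i : Fin (w + 1), gridVertex (N + (k + 1)) w
        (N + snakeRow w (b / (w - 1)) (b % (w - 1)) i)
        (snakeCol w (b / (w - 1)) (b % (w - 1)) i) = v →
        snakeRow w (b / (w - 1)) (b % (w - 1)) i = v.1 - N ∧
        snakeCol w (b / (w - 1)) (b % (w - 1)) i = v.2 := by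
      intro i h
      have := (heq i v hb.le).1 h
      exact ⟨by omega, this.2⟩
    refine ⟨?_, ?_, ?_⟩
    · rintro i ⟨hi, -⟩
      obtain ⟨h1, h2⟩ := hmem i hi
      have h3 := hvS
      rw [← h1, ← h2] at h3
      obtain ⟨h4, h5, h6, h7⟩ := snake_fire_mapsTo hw (hmod b) (hi' i) h3
      rw [Set.mem_ofPred_eq, strongProd_pathGraph_adj, notMem_range_rowsEmbedding,
        Set.mem_ofPred_eq, hfst i (Nat.succ_le_of_lt hb), hsnd, hsr, hsc b i (hi' i),
        Nat.add_sub_cancel_left]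
      exact ⟨by omega, by omega, fun h => h7 h.2⟩
    · rintro i ⟨hi, -⟩ i' ⟨hi2, -⟩ hii
      obtain ⟨h1, h2⟩ := hmem i hi
      obtain ⟨h1', h2'⟩ := hmem i' hi2
      rw [← h1, ← h2] at hvS
      have h3 := congrArg (fun v => (v.2 : ℕ)) hii
      simp only [hsnd] at h3
      rw [hsc b i (hi' i), hsc b i' (hi' i')] at h3
      exact Fin.ext (snake_fire_injOn hw (hmod b) (hi' i) (hi' i') hvS (by omega) (by omega) h3)
    · rintro u ⟨hadj, hu, huP⟩
      rw [strongProd_pathGraph_adj] at hadj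
      rw [notMem_range_rowsEmbedding] at hu
      rw [Set.mem_ofPred_eq, not_and] at huP
      have huP := huP hu
      have hx : (v.1 : ℕ) - N = b / (w - 1) := hvS.1
      have hur : (u.1 : ℕ) - N = b / (w - 1) + 1 := by
        by_contra h
        exact huP (Or.inl (by omega))
      rw [hur] at huP
      obtain ⟨i, hi, h1, h2, h3⟩ :=
        snake_fire_surjOn hw (hmod b) v.2.isLt u.2.isLt hvS (by omega) huP
      have h4 : SnakeFire w (b / (w - 1)) (b % (w - 1))
          (snakeRow w (b / (w - 1)) (b % (w - 1)) i)
          (snakeCol w (b / (w - 1)) (b % (w - 1)) i) := by rwa [h1, h2]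
      have h5 := snake_fire_mapsTo hw (hmod b) hi h4
      refine ⟨⟨i, Nat.lt_succ_iff.mpr hi⟩, ⟨(heq _ _ hb.le).2 ⟨?_, h2⟩, ?_⟩,
        (heq _ _ (Nat.succ_le_of_lt hb)).2 ⟨?_, ?_⟩⟩
      · simp only [h1]; omega
      · simp only [h1]; omega
      · simp only [hsr, h5.2.1]; omega
      · simpa only [hsc b i hi] using h3
  · intro b i hb h
    rw [hS i hb.le] at h
    exact h.1.trans_lt (hdiv hb)
  · intro b i hb h
    rw [hS i hb.le] at h
    obtain ⟨h1, h2, -⟩ := snake_fire_mapsTo hw (hmod b) (hi' i) h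
    rw [hsr, h1, h2]
  · intro b i hb h
    rw [hS i hb.le] at h
    obtain ⟨h1, h2⟩ := snake_stay hw (hmod b) (hi' i) h
    rw [hsr, hsc b i (hi' i), h1, h2]
    exact ⟨rfl, rfl⟩
  · intro b i hb h hlt
    rw [hS i hb.le] at h
    obtain ⟨h1, y, hy, hne, hadj, h2⟩ := snake_blocked_unprot hw (hmod b) (hi' i) h
    have hc := snakeCol_lt (j := b / (w - 1)) (t := b % (w - 1)) hw (hi' i)
    have hle : {j : Fin (w + 1) | gridVertex (N + (k + 1)) w
        (N + snakeRow w (b / (w - 1)) (b % (w - 1)) j) (snakeCol w (b / (w - 1)) (b % (w - 1)) j) =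
        gridVertex (N + (k + 1)) w (N + snakeRow w (b / (w - 1)) (b % (w - 1)) i)
        (snakeCol w (b / (w - 1)) (b % (w - 1)) i) ∧
        snakeRow w (b / (w - 1)) (b % (w - 1)) j < k}.ncard ≤ 1 := by
      rw [Set.ncard_le_one]
      have key : ∀ j : Fin (w + 1), gridVertex (N + (k + 1)) w
          (N + snakeRow w (b / (w - 1)) (b % (w - 1)) j)
          (snakeCol w (b / (w - 1)) (b % (w - 1)) j) =
          gridVertex (N + (k + 1)) w (N + snakeRow w (b / (w - 1)) (b % (w - 1)) i)
          (snakeCol w (b / (w - 1)) (b % (w - 1)) i) → j = i := by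
        intro j hj
        rw [heq j _ hb.le, hfst i hb.le, hsnd] at hj
        exact Fin.ext (snake_blocked_unique hw (hmod b) (hi' i) (hi' j) h (by omega) hj.2)
      intro j hj j' hj'
      rw [key j hj.1, key j' hj'.1]
    refine hle.trans_lt ((Set.one_lt_ncard_iff (Set.toFinite _)).2
      ⟨gridVertex (N + (k + 1)) w (N + (snakeRow w (b / (w - 1)) (b % (w - 1)) i + 1))
        (snakeCol w (b / (w - 1)) (b % (w - 1)) i),
      gridVertex (N + (k + 1)) w (N + (snakeRow w (b / (w - 1)) (b % (w - 1)) i + 1)) y,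
      ?_, ?_, ?_⟩)
    · rw [Set.mem_ofPred_eq, strongProd_pathGraph_adj, notMem_range_rowsEmbedding,
        Set.mem_ofPred_eq, hfst i hb.le, hsnd, gridVertex_fst (by omega), gridVertex_snd hc,
        Nat.add_sub_cancel_left]
      exact ⟨by omega, by omega, fun h => h1 h.2⟩
    · rw [Set.mem_ofPred_eq, strongProd_pathGraph_adj, notMem_range_rowsEmbedding,
        Set.mem_ofPred_eq, hfst i hb.le, hsnd, gridVertex_fst (by omega), gridVertex_snd hy,
        Nat.add_sub_cancel_left]
      exact ⟨by omega, by omega, fun h => h2 h.2⟩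
    · rw [Ne, gridVertex_eq_iff (by omega) hc, gridVertex_snd hy]
      exact fun h => hne h.2.symm
  · rintro b hb v ⟨hv, hvr, hvc⟩ v' ⟨hv', hvr', hvc'⟩ x hadj
    rw [adj_rowsEmbedding hv] at hadj
    have hx := x.1.isLt
    have h0 : b / (w - 1) = 0 := by omega
    have hb' : b < w - 1 := (Nat.div_eq_zero_iff_lt hT).1 h0
    rw [h0, Nat.mod_eq_of_lt hb', flipCol, if_pos rfl] at hvc hvc'
    by_cases hnew : (v'.2 : ℕ) ≤ x.2 + 1 ∧ (x.2 : ℕ) ≤ v'.2 + 1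
    · exact Or.inl ((adj_rowsEmbedding hv').2 ⟨by omega, hnew⟩)
    -- Here `v` and `v'` lie in the last two columns and `x` in column `w - 3 = b - 1`, which the
    -- vertex fired one phase earlier has already awaited.
    · refine Or.inr ⟨b - 1, by omega, (v.1, ⟨b - 1, by omega⟩), ⟨hv, ?_, Or.inl ?_⟩, ?_⟩
      · rw [Nat.div_eq_of_lt (by omega)]
        simp only; omega
      · rw [Nat.div_eq_of_lt (by omega), Nat.mod_eq_of_lt (by omega), flipCol, if_pos rfl]
      · refine (adj_rowsEmbedding (v := (v.1, ⟨b - 1, by omega⟩)) hv).2 ⟨hadj.1, ?_, ?_⟩ <;> simp only <;> omega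
  · intro i hi
    simp [hlast, hlast', snakeRow] at hi

theorem deductionNumber_le_snake (k N w : ℕ) (hw : 3 ≤ w) :
    ((pathGraph (N + (k + 1))).strongProd (pathGraph w)).deductionNumber k ≤
      ((pathGraph N).strongProd (pathGraph w)).deductionNumber k + (w + 1) := by
  have : NeZero (N + (k + 1)) := ⟨by omega⟩
  have : NeZero w := ⟨by omega⟩
  exact (sweep_snake k N w hw).deductionNumber_le

/-! ### Clearing rows of width at most 2. -/

/-- In a grid of at most two columns, a full row of `w` searchers per vertex moves row by row. -/
theorem sweep_narrow (k N h w : ℕ) (hw : 1 ≤ w) (hw2 : w ≤ 2) (hh : h ≤ k) (hN : 1 ≤ h ∨ N = 0)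
    [NeZero (N + (h + 1))] [NeZero w] :
    Sweep (ℓ := w * w) k (rowsEmbedding N (h + 1) w)
      (fun b i => gridVertex (N + (h + 1)) w (N + b) (if b % 2 = 0 then i / w else i % w))
      (fun b _ => b) (fun b => {v | N ≤ v.1 ∧ v.1 ≤ N + b}) (fun b => {v | (v.1 : ℕ) = N + b})
      h := by
  have hcol : ∀ b (i : Fin (w * w)), (if b % 2 = 0 then (i : ℕ) / w else i % w) < w := by
    intro b i
    split_ifs
    · exact (Nat.div_lt_iff_lt_mul hw).2 i.isLt
    · exact Nat.mod_lt _ hw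
  have heq : ∀ {b} (i : Fin (w * w)) (v : Fin (N + (h + 1)) × Fin w), b ≤ h →
      (gridVertex (N + (h + 1)) w (N + b) (if b % 2 = 0 then (i : ℕ) / w else i % w) = v ↔
        N + b = v.1 ∧ (if b % 2 = 0 then (i : ℕ) / w else i % w) = v.2) :=
    fun i v hb => gridVertex_eq_iff (by omega) (hcol _ i)
  have hfst : ∀ {b} y, b ≤ h → ((gridVertex (N + (h + 1)) w (N + b) y).1 : ℕ) = N + b :=
    fun y hb => gridVertex_fst (by omega)
  -- The two base-`w` digits of a label are its columns in even and odd rows, so each ordered pair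
  -- of columns in consecutive rows is used by exactly one searcher.
  have hlabel : ∀ b y z, y < w → z < w → ∃ i : Fin (w * w),
      (if b % 2 = 0 then (i : ℕ) / w else i % w) = y ∧
        (if (b + 1) % 2 = 0 then (i : ℕ) / w else i % w) = z := by
    have key : ∀ y z, y < w → z < w → ∃ i : Fin (w * w), (i : ℕ) / w = y ∧ (i : ℕ) % w = z := by
      intro y z hy hz
      refine ⟨⟨z + w * y, by nlinarith⟩, ?_, ?_⟩
      · simp only [Nat.add_mul_div_left _ _ hw, Nat.div_eq_of_lt hz, Nat.zero_add]
      · simp only [Nat.add_mul_mod_self_left, Nat.mod_eq_of_lt hz]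
    intro b y z hy hz
    by_cases hb : b % 2 = 0
    · obtain ⟨i, h1, h2⟩ := key y z hy hz
      exact ⟨i, by rw [if_pos hb, h1], by rw [if_neg (by omega), h2]⟩
    · obtain ⟨i, h1, h2⟩ := key z y hz hy
      exact ⟨i, by rw [if_neg hb, h2], by rw [if_pos (by omega), h1]⟩
  have hinj : ∀ b (i i' : Fin (w * w)), (if b % 2 = 0 then (i : ℕ) / w else i % w) =
      (if b % 2 = 0 then (i' : ℕ) / w else i' % w) →
      (if (b + 1) % 2 = 0 then (i : ℕ) / w else i % w) =
      (if (b + 1) % 2 = 0 then (i' : ℕ) / w else i' % w) → i = i' := by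
    intro b i i' h1 h2
    have : (i : ℕ) / w = i' / w ∧ (i : ℕ) % w = i' % w := by
      split_ifs at h1 h2 <;> omega
    exact Fin.ext (by rw [← Nat.div_add_mod i w, ← Nat.div_add_mod i' w, this.1, this.2])
  constructor
  · intro b i hb
    rw [notMem_range_rowsEmbedding, hfst _ hb]
    omega
  · intro b hb
    rw [Set.disjoint_left]
    exact fun v hv => notMem_range_rowsEmbedding.2 hv.1
  · intro b x v hb hadj hv
    rw [notMem_range_rowsEmbedding] at hv
    have h1 := (adj_rowsEmbedding hv).1 hadj.symm
    have h2 := x.1.isLt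
    exact ⟨hv, by omega⟩
  · exact fun _ => rfl
  · ext v
    constructor
    · rintro ⟨hv, hv'⟩
      obtain ⟨i, hi, -⟩ := hlabel 0 v.2 v.2 v.2.isLt v.2.isLt
      exact ⟨i, (heq i v (Nat.zero_le _)).2 ⟨by omega, hi⟩⟩
    · rintro ⟨i, hi⟩
      have h1 := ((heq i v (Nat.zero_le _)).1 hi).1
      exact ⟨by omega, by omega⟩
  · intro b hb
    ext v
    simp only [Set.mem_ofPred_eq, Set.mem_range, Set.mem_union, heq _ _ (Nat.succ_le_of_lt hb)]
    constructor
    · rintro ⟨hv, hv'⟩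
      obtain ⟨i, hi, -⟩ := hlabel (b + 1) v.2 v.2 v.2.isLt v.2.isLt
      by_cases hvb : (v.1 : ℕ) ≤ N + b
      · exact Or.inl ⟨hv, hvb⟩
      · exact Or.inr ⟨i, by omega, hi⟩
    · rintro (h | ⟨i, h1, -⟩) <;> omega
  · intro v hv
    rw [notMem_range_rowsEmbedding] at hv
    exact ⟨hv, by omega⟩
  · intro b hb v (hv : (v.1 : ℕ) = N + b)
    exact notMem_range_rowsEmbedding.2 (by omega)
  · intro b hb v (hv : (v.1 : ℕ) = N + b)
    have hvc := v.2.isLt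
    refine ⟨?_, ?_, ?_⟩
    · rintro i -
      have h1 := hcol (b + 1) i
      rw [Set.mem_ofPred_eq, strongProd_pathGraph_adj, notMem_range_rowsEmbedding,
        Set.mem_ofPred_eq, hfst _ (Nat.succ_le_of_lt hb), gridVertex_snd h1]
      omega
    · rintro i ⟨hi, -⟩ i' ⟨hi2, -⟩ hii
      rw [heq i v hb.le] at hi
      rw [heq i' v hb.le] at hi2
      have h3 := congrArg (fun v => (v.2 : ℕ)) hii
      simp only [gridVertex_snd (hcol (b + 1) _)] at h3
      exact hinj b i i' (hi.2.trans hi2.2.symm) h3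
    · rintro u ⟨hadj, hu, huP⟩
      rw [strongProd_pathGraph_adj] at hadj
      rw [notMem_range_rowsEmbedding] at hu
      rw [Set.mem_ofPred_eq] at huP
      obtain ⟨i, h1, h2⟩ := hlabel b v.2 u.2 v.2.isLt u.2.isLt
      exact ⟨i, ⟨(heq i v hb.le).2 ⟨hv.symm, h1⟩, by omega⟩,
        (heq i u (Nat.succ_le_of_lt hb)).2 ⟨by omega, h2⟩⟩
  · exact fun b i hb _ => hb.trans_le hh
  · exact fun _ _ _ _ => rfl
  · exact fun b i hb hi => absurd (hfst _ hb.le) hi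
  · exact fun b i hb hi => absurd (hfst _ hb.le) hi
  · rintro b hb v (hv : (v.1 : ℕ) = N + b) v' (hv' : (v'.1 : ℕ) = N + b) x hadj
    rw [adj_rowsEmbedding (by omega)] at hadj
    have := x.2.isLt
    have := v'.2.isLt
    exact Or.inl ((adj_rowsEmbedding (by omega)).2 (by omega))
  · intro i _ x
    -- The final row may still hold mobile searchers; `hN` keeps it away from the embedded rows, or
    -- makes those empty.
    have := x.1.isLt
    rw [adj_rowsEmbedding (by rw [hfst _ le_rfl]; omega), hfst _ le_rfl]
    omega

theorem deductionNumber_le_narrow (k N h w : ℕ) (hw : 1 ≤ w) (hw2 : w ≤ 2) (hh : h ≤ k)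
    (hN : 1 ≤ h ∨ N = 0) :
    ((pathGraph (N + (h + 1))).strongProd (pathGraph w)).deductionNumber k ≤
      ((pathGraph N).strongProd (pathGraph w)).deductionNumber k + w * w := by
  have : NeZero (N + (h + 1)) := ⟨by omega⟩
  have : NeZero w := ⟨by omega⟩
  exact (sweep_narrow k N h w hw hw2 hh hN).deductionNumber_le

/-! ### Peeling off blocks in both directions. -/

theorem deductionNumber_strongProd_comm_le (k m n : ℕ) :
    ((pathGraph m).strongProd (pathGraph n)).deductionNumber k ≤
      ((pathGraph n).strongProd (pathGraph m)).deductionNumber k :=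
  deductionNumber_le_of_iso k
    { toEquiv := Equiv.prodComm _ _
      map_rel_iff' := by
        intro x y
        simp only [strongProd_pathGraph_adj, Equiv.prodComm_apply, Prod.fst_swap, Prod.snd_swap]
        omega }

theorem deductionNumber_le_of_blocks {k w c : ℕ}
    (h : ∀ N, ((pathGraph (N + (k + 1))).strongProd (pathGraph w)).deductionNumber k ≤
      ((pathGraph N).strongProd (pathGraph w)).deductionNumber k + c) (m : ℕ) :
    ((pathGraph m).strongProd (pathGraph w)).deductionNumber k ≤ c * (m / (k + 1)) +
      ((pathGraph (m % (k + 1))).strongProd (pathGraph w)).deductionNumber k := by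
  have key : ∀ N q, ((pathGraph (N + (k + 1) * q)).strongProd (pathGraph w)).deductionNumber k ≤
      c * q + ((pathGraph N).strongProd (pathGraph w)).deductionNumber k := by
    intro N q
    induction q with
    | zero => simp
    | succ q ih =>
      have := h (N + (k + 1) * q)
      rw [Nat.mul_succ c, Nat.mul_succ (k + 1), ← Nat.add_assoc]
      omega
  have := key (m % (k + 1)) (m / (k + 1))
  rwa [Nat.mod_add_div] at this

theorem deductionNumber_column_le (k m : ℕ) (hk : 1 ≤ k) :
    ((pathGraph m).strongProd (pathGraph 1)).deductionNumber k ≤ ⌈(m : ℚ) / ((k : ℚ) + 1)⌉₊ := by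
  have h1 := deductionNumber_le_of_blocks (k := k) (w := 1) (c := 1)
    (fun N => deductionNumber_le_narrow k N k 1 le_rfl one_le_two le_rfl (Or.inl hk)) m
  have h2 : ⌊(m : ℚ) / ((k : ℚ) + 1)⌋₊ = m / (k + 1) := by
    exact_mod_cast Nat.floor_div_eq_div (K := ℚ) m (k + 1)
  rw [one_mul] at h1
  obtain h0 | h0 := Nat.eq_zero_or_pos (m % (k + 1))
  · rw [h0, deductionNumber_of_isEmpty (V := Fin 0 × Fin 1), add_zero, ← h2] at h1
    exact h1.trans (Nat.floor_le_ceil _)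
  -- An incomplete block costs one more searcher, which the ceiling accounts for.
  · obtain ⟨h, hh⟩ : ∃ h, m % (k + 1) = 0 + (h + 1) := ⟨m % (k + 1) - 1, by omega⟩
    have h3 := deductionNumber_le_narrow k 0 h 1 le_rfl one_le_two
      (by have : m % (k + 1) < k + 1 := Nat.mod_lt m k.succ_pos; omega) (Or.inr rfl)
    rw [deductionNumber_of_isEmpty (V := Fin 0 × Fin 1), ← hh] at h3
    have h4 : m / (k + 1) < ⌈(m : ℚ) / ((k : ℚ) + 1)⌉₊ := by
      rw [Nat.lt_ceil, lt_div_iff₀ (by positivity)]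
      have := Nat.mod_add_div m (k + 1)
      have h5 : m / (k + 1) * (k + 1) < m := by rw [Nat.mul_comm]; omega
      exact_mod_cast h5
    omega

end Deduction

theorem mainTheorem12 (k m n r s : ℕ) (hk : 3 ≤ k) (hm : 3 ≤ m) (hmn : m ≤ n) (hn : k + 1 < n)
    (hr : r = m % (k + 1)) (hs : s = n % (k + 1)) :
    (s = 0 →
      ((((SimpleGraph.pathGraph m).strongProd (SimpleGraph.pathGraph n)).deductionNumber k : ℕ) : ℚ)
        ≤ ((m : ℚ) + 1) * ((n : ℚ) / ((k : ℚ) + 1))) ∧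
    (s = 1 →
      ((SimpleGraph.pathGraph m).strongProd (SimpleGraph.pathGraph n)).deductionNumber k
        ≤ (m + 1) * ⌊(n : ℚ) / ((k : ℚ) + 1)⌋₊ + ⌈(m : ℚ) / ((k : ℚ) + 1)⌉₊) ∧
    (s = 2 →
      ((SimpleGraph.pathGraph m).strongProd (SimpleGraph.pathGraph n)).deductionNumber k
        ≤ (m + 1) * ⌊(n : ℚ) / ((k : ℚ) + 1)⌋₊ + 4 * ⌊(m : ℚ) / ((k : ℚ) + 1)⌋₊
          + ((SimpleGraph.pathGraph r).strongProd (SimpleGraph.pathGraph s)).deductionNumber k) ∧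
    (3 ≤ s →
      ((SimpleGraph.pathGraph m).strongProd (SimpleGraph.pathGraph n)).deductionNumber k
        ≤ (m + 1) * ⌊(n : ℚ) / ((k : ℚ) + 1)⌋₊ + (s + 1) * ⌊(m : ℚ) / ((k : ℚ) + 1)⌋₊
          + ((SimpleGraph.pathGraph r).strongProd (SimpleGraph.pathGraph s)).deductionNumber k) := by
  have hfloor : ∀ a : ℕ, ⌊(a : ℚ) / ((k : ℚ) + 1)⌋₊ = a / (k + 1) := fun a => by
    exact_mod_cast Nat.floor_div_eq_div (K := ℚ) a (k + 1)
  -- The grid is transposed so that blocks of width `m` come off the `n` direction, and the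
  -- remainder is transposed back.
  have hmain : ((SimpleGraph.pathGraph m).strongProd (SimpleGraph.pathGraph n)).deductionNumber k ≤
      (m + 1) * (n / (k + 1)) +
        ((SimpleGraph.pathGraph m).strongProd (SimpleGraph.pathGraph s)).deductionNumber k := by
    have h1 := Deduction.deductionNumber_strongProd_comm_le k m n
    have h2 := Deduction.deductionNumber_le_of_blocks
      (fun N => Deduction.deductionNumber_le_snake k N m hm) n
    have h3 := Deduction.deductionNumber_strongProd_comm_le k (n % (k + 1)) m
    rw [hs]
    omega
  rw [hfloor, hfloor]
  refine ⟨?_, ?_, ?_, fun hs3 => ?_⟩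
  · rintro rfl
    rw [SimpleGraph.deductionNumber_of_isEmpty (V := Fin m × Fin 0), add_zero] at hmain
    have h1 : ((n / (k + 1) : ℕ) : ℚ) = (n : ℚ) / ((k : ℚ) + 1) := by
      rw [Nat.cast_div (Nat.dvd_of_mod_eq_zero hs.symm) (by positivity)]
      push_cast
      rfl
    rw [← h1]
    exact_mod_cast hmain
  · rintro rfl
    exact hmain.trans (Nat.add_le_add_left (Deduction.deductionNumber_column_le k m (by omega)) _)
  · rintro rfl
    have h1 := Deduction.deductionNumber_le_of_blocks (fun N =>
      Deduction.deductionNumber_le_narrow k N k 2 one_le_two le_rfl le_rfl (Or.inl (by omega))) m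
    rw [← hr] at h1
    omega
  · have h1 := Deduction.deductionNumber_le_of_blocks
      (fun N => Deduction.deductionNumber_le_snake k N s hs3) m
    rw [← hr] at h1
    omega
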